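/- A \emph{rig} is a commutative semiring $(A,\cdot,1,+,0)$, pre-ordered by $x\le y$ iff $w+x=y$ for some $w$. It is \emph{integral} if $1+x=1$ for all $x$, and \emph{residuated} if addition is idempotent and for every $a\in A$ the map $a\cdot(\_):A\to A$ has a right adjoint $a\multimap(\_)$ with respect to $\le$. A morphism of residuated rigs is a rig morphism with $f(x\multimap y)=f(x)\multimap f(y)$. Let $\mathbf{riRig}$ be the category of residuated integral rigs (in $\mathbf{Set}$) and these morphisms. For a distributive lattice $D$ (with $\bot$ and $\top$), let $\mathbf{Shv}(D)$ be the topos of sheaves on $D$ for the coverage in which $d\in D$ is covered by the finite families $(d_i\le d)_{i\in I}$ with $\bigvee_i d_i=d$. For a rig $X$ in $\mathbf{Shv}(D)$, $x\in X(d)$ and $c\le d$, write $x\cdot c\in X(c)$ for the restriction of $x$. The rig $X$ is \emph{really local} if the map $\iota:X\to\Omega$ to the subobject classifier that classifies the subobject of invertible elements is a morphism of rigs. Let $\Lambda_D$ be the sheaf $\Lambda_D(d)=\{c\in D\mid c\le d\}$, with restriction given by meets. A \emph{representation} is a pair $(D,X)$ where $D$ is a distributive lattice and $X$ is a really local integral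 rig in $\mathbf{Shv}(D)$ such that for all $d\in D$ and $x\in X(d)$ there is a largest $c\le d$ with $x\cdot c=1$; call this element $\chi_X(x)$, so that $\chi_X:X\to\Lambda_D$. A map of representations $(D,X)\to(E,Y)$ is a pair $(f,\phi)$ where $f:D\to E$ is a morphism of lattices (preserving $\bot$ and $\top$) and $\phi:X\to f_*Y$ is a morphism of rigs in $\mathbf{Shv}(D)$, with $(f_*Y)(d)=Y(f(d))$, such that $f_*(\chi_Y)\circ\phi=f\circ\chi_X$ as maps $X\to f_*\Lambda_E$. The composite of $(g,\gamma):(C,W)\to(D,X)$ and $(f,\phi):(D,X)\to(E,Y)$ is $(fg,(g_*\phi)\gamma)$. Let $\mathfrak{rI}$ be the category whose objects are the representations $(D,X)$ such that $X$ is residuated in $\mathbf{Shv}(D)$ (that is, every $X(d)$ is residuated and restriction maps preserve $\multimap$) and whose maps are the maps $(f,\phi)$ of representations such that $\phi$ preserves $\multimap$. Let $\Gamma:\mathfrak{rI}\to\mathbf{riRig}$ be the functor of global sections, $\Gamma(D,X)=X(\top)$, $\Gamma(f,\phi)=\phi_\top:X(\top)\to Y(f(\top))=Y(\top)$. \textbf{Corollary.}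 The functor $\Gamma:\mathfrak{rI}\to\mathbf{riRig}$ has a full and faithful left adjoint. -/

import Mathlib

open CategoryTheory Opposite

universe u

noncomputable section

/-! ## Rigs

A rig is a commutative semiring; the category of rigs is `CommSemiRingCat`. -/

/-- The canonical pre-order of a rig: `x ≤ y` iff `w + x = y` for some `w`. -/
def Rig.Le {A : Type u} [CommSemiring A] (x y : A) : Prop := ∃ w, w + x = y

/-- A rig is integral if `1 + x = 1` holds. -/
def Rig.Integral (A : Type u) [CommSemiring A] : Prop := ∀ x : A, 1 + x = 1

/-- A rig is residuated if its addition is idempotent and every `a * (_)` has a right adjoint with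
respect to the canonical pre-order (which is then a partial order). -/
structure Rig.Residuated (A : Type u) [CommSemiring A] : Prop where
  add_self : ∀ a : A, a + a = a
  exists_adjoint : ∀ a : A, ∃ r : A → A, ∀ x y, Rig.Le (a * x) y ↔ Rig.Le x (r y)

/-- The residual `a ⊸ b`: the value at `b` of the right adjoint of `a * (_)`. -/
def Rig.Residuated.imp {A : Type u} [CommSemiring A] (h : Rig.Residuated A) (a b : A) : A :=
  (h.exists_adjoint a).choose b

theorem Rig.Residuated.mul_le_iff {A : Type u} [CommSemiring A] (h : Rig.Residuated A)
    (a x b : A) : Rig.Le (a * x) b ↔ Rig.Le x (h.imp a b) :=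
  (h.exists_adjoint a).choose_spec x b

/-- The residual is determined by the adjunction. -/
theorem Rig.Residuated.eq_imp {A : Type u} [CommSemiring A] (h : Rig.Residuated A)
    {a b c : A} (hc : ∀ x, Rig.Le (a * x) b ↔ Rig.Le x c) : c = h.imp a b := by
  have antisymm : ∀ x y : A, Rig.Le x y → Rig.Le y x → x = y := by
    rintro x y ⟨v, hv⟩ ⟨w, hw⟩
    have h1 : y + x = y := by rw [← hv, add_assoc, h.add_self]
    have h2 : x + y = x := by rw [← hw, add_assoc, h.add_self]
    rw [← h2, add_comm, h1]
  have refl : ∀ x : A, Rig.Le x x := fun x => ⟨0, zero_add x⟩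
  exact antisymm _ _ ((h.mul_le_iff a c b).1 ((hc c).2 (refl c)))
    ((hc _).1 ((h.mul_le_iff a _ b).2 (refl _)))

/-- A residuated integral rig. -/
structure RiRig : Type (u + 1) where
  rig : CommSemiRingCat.{u}
  integral : Rig.Integral rig
  residuated : Rig.Residuated rig

namespace RiRig

/-- A morphism of residuated (integral) rigs: a rig morphism that preserves residuals. -/
@[ext]
structure Hom (A B : RiRig.{u}) where
  hom : A.rig ⟶ B.rig
  map_imp : ∀ x y : A.rig, hom (A.residuated.imp x y) = B.residuated.imp (hom x) (hom y)

/-- The category of residuated integral rigs. -/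
instance : Category RiRig.{u} where
  Hom := Hom
  id A := ⟨𝟙 A.rig, fun _ _ => rfl⟩
  comp f g := ⟨f.hom ≫ g.hom, fun x y => by simp [f.map_imp, g.map_imp]⟩

end RiRig

/-! ## Sheaves on a distributive lattice -/

/-- The topology on a bounded distributive lattice `D` (seen as a category) generated by the
coherent coverage, whose covers of `d` are the finite families of elements `≤ d` with supremum `d`:
a sieve on `d` is covering iff it contains such a family. -/
def latticeTopology (D : Type u) [DistribLattice D] [BoundedOrder D] : GrothendieckTopology D where
  sieves d := {S | ∃ t : Finset D, (∀ c ∈ t, ∃ h : c ≤ d, S (homOfLE h)) ∧ t.sup id = d}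
  top_mem' d := ⟨{d}, by simp⟩
  pullback_stable' := by
    classical
    rintro d e S g ⟨t, ht, hd⟩
    refine ⟨t.image (fun c => c ⊓ e), ?_, ?_⟩
    · intro c hc
      obtain ⟨c', hc', rfl⟩ := Finset.mem_image.1 hc
      obtain ⟨h, hS⟩ := ht c' hc'
      refine ⟨inf_le_right, ?_⟩
      have := S.downward_closed hS (homOfLE (inf_le_left : c' ⊓ e ≤ c'))
      exact this
    · rw [Finset.sup_image]
      have h1 : (t.sup id) ⊓ e = t.sup (fun c => c ⊓ e) := by
        rw [Finset.sup_inf_distrib_right]; rfl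
      have h2 : (t.sup id) ⊓ e = e := by rw [hd]; exact inf_eq_right.2 (leOfHom g)
      exact h1.symm.trans h2
  transitive' := by
    classical
    rintro d S ⟨t, ht, hd⟩ R hR
    have key : ∀ c : D, ∃ s : Finset D, c ∈ t →
        (∀ b ∈ s, ∃ h : b ≤ d, R (homOfLE h)) ∧ s.sup id = c := by
      intro c
      by_cases hc : c ∈ t
      · obtain ⟨h, hS⟩ := ht c hc
        obtain ⟨s, hs, hsc⟩ := hR hS
        refine ⟨s, fun _ => ⟨fun b hb => ?_, hsc⟩⟩
        obtain ⟨h', hb'⟩ := hs b hb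
        exact ⟨h'.trans h, hb'⟩
      · exact ⟨∅, fun h => absurd h hc⟩
    choose s hs using key
    refine ⟨t.biUnion s, ?_, ?_⟩
    · intro b hb
      obtain ⟨c, hc, hb⟩ := Finset.mem_biUnion.1 hb
      exact (hs c hc).1 b hb
    · rw [Finset.sup_biUnion, ← hd]
      exact Finset.sup_congr rfl fun c hc => (hs c hc).2

section Presheaf

variable {D : Type u} [DistribLattice D]

/-- The restriction `x · c` of `x ∈ X d` along `c ≤ d`. -/
abbrev restrict (X : Dᵒᵖ ⥤ CommSemiRingCat.{u}) {c d : D} (h : c ≤ d) :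
    X.obj (op d) →+* X.obj (op c) :=
  (X.map (homOfLE h).op).hom

/-- The map `ι : X ⟶ Ω` classifying the subobject `Inv X` of invertible elements, on sections:
`ι x` is the sieve on `d` of all `c ≤ d` such that `x · c` is invertible. -/
def invSieve (X : Dᵒᵖ ⥤ CommSemiRingCat.{u}) {d : D} (x : X.obj (op d)) : Sieve d where
  arrows _ g := IsUnit ((X.map g.op).hom x)
  downward_closed {_ _ f} hf g := by
    have h : (X.map (g ≫ f).op).hom x = (X.map g.op).hom ((X.map f.op).hom x) := by
      rw [op_comp, X.map_comp]; rfl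
    rw [h]
    exact hf.map _

/-- A rig `X` in the topos of sheaves on `D` is really local if `ι : X ⟶ Ω` is a morphism of rigs.
Here `Ω d` is the lattice of closed sieves on `d`; its bottom is the closure of the empty sieve, and
the join of two closed sieves is the closure of their union. -/
structure IsReallyLocal [BoundedOrder D] (X : Dᵒᵖ ⥤ CommSemiRingCat.{u}) : Prop where
  map_zero : ∀ d : D, invSieve X (0 : X.obj (op d)) = (latticeTopology D).close ⊥
  map_add : ∀ (d : D) (x y : X.obj (op d)),
    invSieve X (x + y) = (latticeTopology D).close (invSieve X x ⊔ invSieve X y)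
  map_one : ∀ d : D, invSieve X (1 : X.obj (op d)) = ⊤
  map_mul : ∀ (d : D) (x y : X.obj (op d)), invSieve X (x * y) = invSieve X x ⊓ invSieve X y

/-- The subobject `1 : 1 ⟶ X` is principal: for every `x ∈ X d` there is a largest `c ≤ d` such
that `x · c = 1`. -/
def IsPrincipalOne (X : Dᵒᵖ ⥤ CommSemiRingCat.{u}) : Prop :=
  ∀ (d : D) (x : X.obj (op d)), ∃ c : D, IsGreatest {c | ∃ h : c ≤ d, restrict X h x = 1} c

/-- The classifying map `χ : X ⟶ Λ` of the principal subobject `1 : 1 ⟶ X`, on sections: here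
`Λ d = {c | c ≤ d}` and `χ x` is the largest `c ≤ d` such that `x · c = 1`. -/
def IsPrincipalOne.chi {X : Dᵒᵖ ⥤ CommSemiRingCat.{u}} (h : IsPrincipalOne X) {d : D}
    (x : X.obj (op d)) : Set.Iic d :=
  ⟨(h d x).choose, (h d x).choose_spec.1.1⟩

theorem IsPrincipalOne.isGreatest_chi {X : Dᵒᵖ ⥤ CommSemiRingCat.{u}} (h : IsPrincipalOne X)
    {d : D} (x : X.obj (op d)) :
    IsGreatest {c | ∃ h : c ≤ d, restrict X h x = 1} (h.chi x : D) :=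
  (h d x).choose_spec

end Presheaf

/-! ## Representations -/

/-- A representation of an integral rig: a pair `(D, X)` of a distributive lattice and an integral
rig `X` in the topos of sheaves on `D` (a presheaf of integral rigs whose underlying presheaf of
sets is a sheaf) which is really local and such that `1 : 1 ⟶ X` is principal. -/
structure RigRepresentation : Type (u + 1) where
  D : BddDistLat.{u}
  X : (D : Type u)ᵒᵖ ⥤ CommSemiRingCat.{u}
  isSheaf : Presieve.IsSheaf (latticeTopology D) (X ⋙ forget CommSemiRingCat.{u})
  integral : ∀ d : D, Rig.Integral (X.obj (op d))
  reallyLocal : IsReallyLocal X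
  principal : IsPrincipalOne X

namespace RigRepresentation

/-- A lattice morphism `f : D ⟶ E` as a functor between the lattices seen as categories. -/
abbrev latticeFunctor {D E : BddDistLat.{u}} (f : D ⟶ E) : (D : Type u) ⥤ (E : Type u) :=
  (OrderHomClass.mono f.hom).functor

/-- The map `Λ_D ⟶ f_* Λ_E` induced by `f`, on sections: `a ≤ d` is sent to `f a ≤ f d`. -/
def lambdaMap {D E : BddDistLat.{u}} (f : D ⟶ E) {d : D} (a : Set.Iic d) : Set.Iic (f d) :=
  ⟨f a, OrderHomClass.mono f.hom a.2⟩

/-- A map `(D, X) ⟶ (E, Y)` of representations: a lattice morphism `f : D ⟶ E` and a rig morphism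
`φ : X ⟶ f_* Y` (where `(f_* Y) d = Y (f d)`) such that the square formed by `φ`, `f`, `χ_X` and
`f_* χ_Y` commutes. -/
structure Hom (P Q : RigRepresentation.{u}) where
  f : P.D ⟶ Q.D
  φ : P.X ⟶ (latticeFunctor f).op ⋙ Q.X
  comm : ∀ (d : P.D) (x : P.X.obj (op d)),
    Q.principal.chi (d := f d) ((φ.app (op d)).hom x) = lambdaMap f (P.principal.chi x)

/-- The identity of `(D, X)`. -/
def Hom.id (P : RigRepresentation.{u}) : Hom P P where
  f := 𝟙 P.D
  φ := { app := fun d => 𝟙 (P.X.obj d)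
         naturality := fun _ _ _ => rfl }
  comm _ _ := rfl

/-- The composite of `(g, γ) : (C, W) ⟶ (D, X)` and `(f, φ) : (D, X) ⟶ (E, Y)` is
`(f g, (g_* φ) γ)`. -/
def Hom.comp {P Q R : RigRepresentation.{u}} (g : Hom P Q) (f : Hom Q R) : Hom P R where
  f := g.f ≫ f.f
  φ := { app := fun d => g.φ.app d ≫ f.φ.app (op (g.f d.unop))
         naturality := fun _ _ t => by
          have h1 := g.φ.naturality t
          have h2 := f.φ.naturality ((latticeFunctor g.f).op.map t)
          exact ((Category.assoc _ _ _).symm.trans (congrArg (· ≫ _) h1)).trans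
            ((Category.assoc _ _ _).trans ((congrArg (g.φ.app _ ≫ ·) h2).trans
              (Category.assoc _ _ _).symm)) }
  comm d x := by
    have h1 := g.comm d x
    have h2 := f.comm (g.f d) ((g.φ.app (op d)).hom x)
    rw [h1] at h2
    exact h2

/-- The category of representations. -/
instance : Category RigRepresentation.{u} where
  Hom := Hom
  id := Hom.id
  comp := Hom.comp
  id_comp _ := rfl
  comp_id _ := rfl
  assoc _ _ _ := rfl

/-- Global sections of a representation, as a functor to rigs: `(D, X)` is sent to `X ⊤` and
`(f, φ)` to `φ_⊤ : X ⊤ ⟶ Y (f ⊤) = Y ⊤`. -/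
def globalSections : RigRepresentation.{u} ⥤ CommSemiRingCat.{u} where
  obj P := P.X.obj (op ⊤)
  map {P Q} h := h.φ.app (op ⊤) ≫ Q.X.map (homOfLE (map_top h.f.hom).ge).op
  map_id P := by
    change 𝟙 _ ≫ P.X.map (𝟙 _) = _
    rw [P.X.map_id, Category.id_comp]
  map_comp {P Q R} g f := by
    ext x
    have h1 := congrArg (fun k => k.hom ((g.φ.app (op ⊤)).hom x))
      (f.φ.naturality (homOfLE (map_top g.f.hom).ge).op)
    have h2 := congrArg (fun k => k.hom ((f.φ.app (op (g.f ⊤))).hom ((g.φ.app (op ⊤)).hom x)))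
      (R.X.map_comp ((latticeFunctor f.f).map (homOfLE (map_top g.f.hom).ge)).op
        (homOfLE (map_top f.f.hom).ge).op)
    exact h2.trans
      (congrArg (fun z => (R.X.map (homOfLE (map_top f.f.hom).ge).op).hom z) h1.symm)

end RigRepresentation

/-- A representation `(D, X)` such that `X` is residuated in the topos of sheaves on `D`: the rigs
of sections are residuated and residuals are stable under restriction. -/
structure ResiduatedRigRepresentation : Type (u + 1) extends RigRepresentation.{u} where
  residuated : ∀ d : D, Rig.Residuated (X.obj (op d))
  restrict_imp : ∀ {c d : D} (h : c ≤ d) (x y : X.obj (op d)),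
    restrict X h ((residuated d).imp x y) =
      (residuated c).imp (restrict X h x) (restrict X h y)

namespace ResiduatedRigRepresentation

/-- A map of residuated representations: a map `(f, φ)` of representations such that
`φ : X ⟶ f_* Y` preserves residuals. -/
@[ext]
structure Hom (P Q : ResiduatedRigRepresentation.{u}) where
  hom : P.toRigRepresentation ⟶ Q.toRigRepresentation
  map_imp : ∀ (d : P.D) (x y : P.X.obj (op d)),
    (hom.φ.app (op d)).hom ((P.residuated d).imp x y) =
      (Q.residuated (hom.f d)).imp ((hom.φ.app (op d)).hom x) ((hom.φ.app (op d)).hom y)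

/-- The category of residuated representations. -/
instance : Category ResiduatedRigRepresentation.{u} where
  Hom := Hom
  id P := ⟨𝟙 P.toRigRepresentation, fun _ _ _ => rfl⟩
  comp g f := ⟨g.hom ≫ f.hom, fun d x y => by
    have h1 := g.map_imp d x y
    have h2 := f.map_imp (g.hom.f d) ((g.hom.φ.app (op d)).hom x) ((g.hom.φ.app (op d)).hom y)
    rw [← h1] at h2
    exact h2⟩

/-- The global sections functor `Γ` from residuated representations to residuated integral rigs,
`Γ (D, X) = X ⊤`. -/
def Gamma : ResiduatedRigRepresentation.{u} ⥤ RiRig.{u} where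
  obj P :=
    { rig := RigRepresentation.globalSections.obj P.toRigRepresentation
      integral := P.integral ⊤
      residuated := P.residuated ⊤ }
  map {P Q} h :=
    { hom := RigRepresentation.globalSections.map h.hom
      map_imp := fun x y => by
        have h1 := h.map_imp ⊤ x y
        have h2 := Q.restrict_imp (map_top h.hom.f.hom).ge
          ((h.hom.φ.app (op ⊤)).hom x) ((h.hom.φ.app (op ⊤)).hom y)
        rw [← h1] at h2
        exact h2 }
  map_id P := RiRig.Hom.ext (RigRepresentation.globalSections.map_id P.toRigRepresentation)
  map_comp g f := RiRig.Hom.ext (RigRepresentation.globalSections.map_comp g.hom f.hom)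

end ResiduatedRigRepresentation

end

noncomputable section

namespace Rig

/-! ### The canonical pre-order of a rig. -/

section Order

variable {A : Type u} [CommSemiring A] {x y z x' y' : A}

/-! In an integral rig `1` is the largest element and the only unit, so inverting `u` means forcing
`u = 1`, and localizations are quotients. The base lattice is the reticulation: elements are
compared up to powers, with joins and meets given by sum and product; that sums are joins is
`add_pow_le`. Over `d` the structure sheaf forces `u = 1` for all `u` whose class is above `d`:
there `x ≤ y` means `u * x ≤ y` for some such `u`. Separatedness comes from `LeOn.sup` and gluing
from `exists_glue_pair`; `χ` sends a section `x` over `d` to `d ⊓ mk x`.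

Given a representation `P` and a rig map `g` to its global sections, `χ ∘ g` is a lattice-valued rig
map, so it factors through the reticulation. Over the image of `d` every `g u` with `d ≤ mk u`
restricts to `1`, so `g` descends to local sections. Compatibility with `χ` forces the lattice
component and naturality forces the rest, since every section comes from `A`. Residuals survive
because `u * (x * z) ≤ y` iff `u * z ≤ x ⊸ y`.

Over `⊤` only `u = 1` is inverted, so the unit is an isomorphism; hence the left adjoint is full and
faithful. -/

theorem Le.refl (x : A) : Le x x := ⟨0, zero_add x⟩

theorem Le.trans (h : Le x y) (h' : Le y z) : Le x z := by
  obtain ⟨v, rfl⟩ := h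
  obtain ⟨w, rfl⟩ := h'
  exact ⟨w + v, add_assoc w v x⟩

theorem Le.add (h : Le x y) (h' : Le x' y') : Le (x + x') (y + y') := by
  obtain ⟨v, rfl⟩ := h
  obtain ⟨w, rfl⟩ := h'
  exact ⟨v + w, add_add_add_comm v w x x'⟩

theorem Le.mul (h : Le x y) (h' : Le x' y') : Le (x * x') (y * y') := by
  obtain ⟨v, rfl⟩ := h
  obtain ⟨w, rfl⟩ := h'
  exact ⟨v * w + v * x' + x * w, by ring⟩

theorem Le.pow (h : Le x y) (n : ℕ) : Le (x ^ n) (y ^ n) := by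
  induction n with
  | zero => simpa using Le.refl (1 : A)
  | succ n ih => simpa only [pow_succ] using ih.mul h

theorem Le.map {B : Type u} [CommSemiring B] (f : A →+* B) (h : Le x y) : Le (f x) (f y) := by
  obtain ⟨w, rfl⟩ := h
  exact ⟨f w, (map_add f w x).symm⟩

theorem zero_le (x : A) : Le 0 x := ⟨x, add_zero x⟩

theorem le_add_left (x y : A) : Le x (y + x) := ⟨y, rfl⟩

theorem le_add_right (x y : A) : Le x (x + y) := ⟨y, add_comm y x⟩

/-! ### Integral rigs. -/

namespace Integral

variable (hA : Integral A)
include hA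

theorem add_self (x : A) : x + x = x := by
  have h := congrArg (x * ·) (hA 1)
  simpa [mul_add] using h

theorem le_iff : Le x y ↔ x + y = y := by
  refine ⟨?_, fun h => ⟨y, by rw [add_comm, h]⟩⟩
  rintro ⟨w, rfl⟩
  rw [add_left_comm, hA.add_self]

theorem antisymm (h : Le x y) (h' : Le y x) : x = y := by
  rw [hA.le_iff] at h h'
  rw [← h, add_comm, h']

theorem le_one (x : A) : Le x 1 := ⟨1, hA x⟩

theorem one_le_iff : Le 1 x ↔ x = 1 :=
  ⟨fun h => hA.antisymm (hA.le_one x) h, fun h => h ▸ Le.refl x⟩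

theorem mul_le_left (x y : A) : Le (x * y) x := by
  simpa using (Le.refl x).mul (hA.le_one y)

theorem mul_le_right (x y : A) : Le (x * y) y := by
  simpa using (hA.le_one x).mul (Le.refl y)

theorem add_le (h : Le x z) (h' : Le y z) : Le (x + y) z := by
  simpa [hA.add_self] using h.add h'

theorem isUnit_iff : IsUnit x ↔ x = 1 := by
  refine ⟨fun h => ?_, fun h => h ▸ isUnit_one⟩
  obtain ⟨y, hy⟩ := h.exists_right_inv
  exact hA.one_le_iff.1 (hy ▸ hA.mul_le_left x y)

theorem mul_eq_one_iff : x * y = 1 ↔ x = 1 ∧ y = 1 := by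
  simp only [← hA.isUnit_iff, IsUnit.mul_iff]

/-- Pigeonhole: every monomial of degree `m + n` is divisible by `x ^ m` or `y ^ n`, and multiples
are smaller. The induction splits off one factor `x + y` and lowers `m` or `n` accordingly. -/
theorem add_pow_le (x y : A) : ∀ m n : ℕ, Le ((x + y) ^ (m + n)) (x ^ m + y ^ n)
  | 0, n => by simpa [hA _] using hA.le_one ((x + y) ^ n)
  | m + 1, 0 => by simpa [add_comm _ (1 : A), hA _] using hA.le_one ((x + y) ^ (m + 1))
  | m + 1, n + 1 => by
    have h1 : Le ((x + y) ^ (m + (n + 1)) * x) (x ^ (m + 1) + y ^ (n + 1)) := by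
      refine ((add_pow_le x y m (n + 1)).mul (Le.refl x)).trans ?_
      rw [add_mul, ← pow_succ]
      exact (Le.refl _).add (hA.mul_le_left _ _)
    have h2 : Le ((x + y) ^ (m + 1 + n) * y) (x ^ (m + 1) + y ^ (n + 1)) := by
      refine ((add_pow_le x y (m + 1) n).mul (Le.refl y)).trans ?_
      rw [add_mul, ← pow_succ]
      exact (hA.mul_le_left _ _).add (Le.refl _)
    have h3 : (x + y) ^ (m + 1 + (n + 1)) =
        (x + y) ^ (m + (n + 1)) * x + (x + y) ^ (m + 1 + n) * y := by
      ring
    rw [h3]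
    exact hA.add_le h1 h2

end Integral

end Order

/-! ## The reticulation of an integral rig -/

section Reticulation

variable (A : Type u) [CommSemiring A]

/-- The pre-order on a rig in which `x` is below `y` iff `x ^ n ≤ y` for some `n`. -/
def reticulationSetoid : Setoid A where
  r x y := (∃ n : ℕ, Le (x ^ n) y) ∧ ∃ n : ℕ, Le (y ^ n) x
  iseqv :=
    { refl x := ⟨⟨1, by simpa using Le.refl x⟩, ⟨1, by simpa using Le.refl x⟩⟩
      symm h := h.symm
      trans := by
        rintro x y z ⟨⟨k, hk⟩, ⟨l, hl⟩⟩ ⟨⟨m, hm⟩, ⟨n, hn⟩⟩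
        exact ⟨⟨k * m, pow_mul x k m ▸ (hk.pow m).trans hm⟩,
          ⟨n * l, pow_mul z n l ▸ (hn.pow l).trans hl⟩⟩ }

/-- The reticulation of a rig: its reflection in distributive lattices when the rig is integral. -/
def Reticulation : Type u := Quotient (reticulationSetoid A)

variable {A}

/-- The class of an element in the reticulation. -/
def Reticulation.mk (x : A) : Reticulation A := Quotient.mk (reticulationSetoid A) x

namespace Reticulation

theorem mk_surjective : Function.Surjective (mk : A → Reticulation A) := Quotient.mk_surjective

instance : PartialOrder (Reticulation A) where
  le := Quotient.lift₂ (fun x y => ∃ n : ℕ, Le (x ^ n) y) (by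
    rintro x y x' y' ⟨⟨k, hk⟩, ⟨l, hl⟩⟩ ⟨⟨m, hm⟩, ⟨n, hn⟩⟩
    refine propext ⟨fun ⟨i, hi⟩ => ⟨l * (i * m), ?_⟩, fun ⟨i, hi⟩ => ⟨k * (i * n), ?_⟩⟩
    · rw [pow_mul, pow_mul]
      exact ((hl.pow i).trans hi |>.pow m).trans hm
    · rw [pow_mul, pow_mul]
      exact ((hk.pow i).trans hi |>.pow n).trans hn)
  le_refl := by
    rintro ⟨x⟩
    exact ⟨1, by simpa using Le.refl x⟩
  le_trans := by
    rintro ⟨x⟩ ⟨y⟩ ⟨z⟩ ⟨m, hm⟩ ⟨n, hn⟩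
    exact ⟨m * n, pow_mul x m n ▸ (hm.pow n).trans hn⟩
  le_antisymm := by
    rintro ⟨x⟩ ⟨y⟩ h h'
    exact Quotient.sound ⟨h, h'⟩

theorem mk_le_mk {x y : A} : mk x ≤ mk y ↔ ∃ n : ℕ, Le (x ^ n) y := Iff.rfl

theorem mk_mono {x y : A} (h : Le x y) : mk x ≤ mk y := mk_le_mk.2 ⟨1, by simpa using h⟩

theorem mk_le_mk_pow (x : A) (n : ℕ) : mk x ≤ mk (x ^ n) := mk_le_mk.2 ⟨n, Le.refl _⟩

variable [hA : Fact (Integral A)]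

/-- The universal property of the join; exponents `m` and `n` for the summands give `m + n` by
`add_pow_le`. -/
theorem mk_add_le {x y z : A} : mk (x + y) ≤ mk z ↔ mk x ≤ mk z ∧ mk y ≤ mk z := by
  refine ⟨fun h => ⟨(mk_mono (le_add_right _ _)).trans h, (mk_mono (le_add_left _ _)).trans h⟩, ?_⟩
  rintro ⟨⟨m, hm⟩, ⟨n, hn⟩⟩
  exact ⟨m + n, (hA.out.add_pow_le x y m n).trans (hA.out.add_le hm hn)⟩

theorem le_mk_mul {x y z : A} : mk z ≤ mk (x * y) ↔ mk z ≤ mk x ∧ mk z ≤ mk y := by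
  refine ⟨fun h => ⟨h.trans (mk_mono (hA.out.mul_le_left _ _)),
    h.trans (mk_mono (hA.out.mul_le_right _ _))⟩, ?_⟩
  rintro ⟨⟨m, hm⟩, ⟨n, hn⟩⟩
  exact ⟨m + n, pow_add z m n ▸ hm.mul hn⟩

instance : DistribLattice (Reticulation A) :=
  let L : Lattice (Reticulation A) :=
    { (inferInstance : PartialOrder (Reticulation A)) with
      -- The universal properties `mk_add_le` and `le_mk_mul` already determine the classes of sums
      -- and products, so independence of representatives is a comparison of bounds.
      sup := Quotient.map₂ (· + ·) (by
        intro x x' h y y' h'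
        have h1 : mk x = mk x' := Quotient.sound h
        have h2 : mk y = mk y' := Quotient.sound h'
        refine ⟨mk_add_le.2 ⟨?_, ?_⟩, mk_add_le.2 ⟨?_, ?_⟩⟩
        · exact h1.le.trans (mk_mono (le_add_right _ _))
        · exact h2.le.trans (mk_mono (le_add_left _ _))
        · exact h1.ge.trans (mk_mono (le_add_right _ _))
        · exact h2.ge.trans (mk_mono (le_add_left _ _)))
      inf := Quotient.map₂ (· * ·) (by
        intro x x' h y y' h'
        have h1 : mk x = mk x' := Quotient.sound h
        have h2 : mk y = mk y' := Quotient.sound h'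
        refine ⟨le_mk_mul.2 ⟨?_, ?_⟩, le_mk_mul.2 ⟨?_, ?_⟩⟩
        · exact (mk_mono (hA.out.mul_le_left _ _)).trans h1.le
        · exact (mk_mono (hA.out.mul_le_right _ _)).trans h2.le
        · exact (mk_mono (hA.out.mul_le_left _ _)).trans h1.ge
        · exact (mk_mono (hA.out.mul_le_right _ _)).trans h2.ge)
      le_sup_left := by
        rintro ⟨x⟩ ⟨y⟩
        exact mk_mono (le_add_right x y)
      le_sup_right := by
        rintro ⟨x⟩ ⟨y⟩
        exact mk_mono (le_add_left y x)
      sup_le := by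
        rintro ⟨x⟩ ⟨y⟩ ⟨z⟩ h h'
        exact mk_add_le.2 ⟨h, h'⟩
      inf_le_left := by
        rintro ⟨x⟩ ⟨y⟩
        exact mk_mono (hA.out.mul_le_left x y)
      inf_le_right := by
        rintro ⟨x⟩ ⟨y⟩
        exact mk_mono (hA.out.mul_le_right x y)
      le_inf := by
        rintro ⟨x⟩ ⟨y⟩ ⟨z⟩ h h'
        exact le_mk_mul.2 ⟨h, h'⟩ }
  { L with
    le_sup_inf := by
      rintro ⟨x⟩ ⟨y⟩ ⟨z⟩
      refine mk_mono (x := (x + y) * (x + z)) (y := x + y * z) ?_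
      rw [mul_add]
      refine hA.out.add_le ((hA.out.mul_le_right _ _).trans (le_add_right _ _)) ?_
      rw [add_mul]
      exact hA.out.add_le ((hA.out.mul_le_left _ _).trans (le_add_right _ _)) (le_add_left _ _) }

instance : BoundedOrder (Reticulation A) where
  top := mk 1
  le_top := by
    rintro ⟨x⟩
    exact mk_mono (hA.out.le_one x)
  bot := mk 0
  bot_le := by
    rintro ⟨x⟩
    exact mk_mono (zero_le x)

theorem mk_add (x y : A) : mk (x + y) = mk x ⊔ mk y := rfl

theorem mk_zero : mk (0 : A) = ⊥ := rfl

/-- The universal property of the reticulation. -/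
def lift {E : Type u} [DistribLattice E] [BoundedOrder E] (χ : A → E) (h0 : χ 0 = ⊥) (h1 : χ 1 = ⊤)
    (hadd : ∀ x y, χ (x + y) = χ x ⊔ χ y) (hmul : ∀ x y, χ (x * y) = χ x ⊓ χ y) :
    BoundedLatticeHom (Reticulation A) E :=
  -- Meets are idempotent, so `χ` does not see positive powers; for `n = 0` the bound is `χ 1 = ⊤`.
  have mono : ∀ (x y : A) (n : ℕ), Le (x ^ n) y → χ x ≤ χ y := by
    rintro x y n ⟨w, rfl⟩
    rw [hadd]
    refine le_trans ?_ le_sup_right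
    induction n with
    | zero => simp [h1]
    | succ n ih => simpa [pow_succ, hmul] using ih
  { toFun := Quotient.lift χ fun x y ⟨⟨m, hm⟩, ⟨n, hn⟩⟩ => le_antisymm (mono x y m hm) (mono y x n hn)
    map_sup' := by
      rintro ⟨x⟩ ⟨y⟩
      exact hadd x y
    map_inf' := by
      rintro ⟨x⟩ ⟨y⟩
      exact hmul x y
    map_top' := h1
    map_bot' := h0 }

end Reticulation

end Reticulation

end Rig

/-! ## Closed sieves on a distributive lattice -/

section Close

variable {D : Type u} [DistribLattice D] [BoundedOrder D] {d e : D}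

/-- The empty family covers `⊥` and nothing else. -/
theorem close_bot_iff (f : e ⟶ d) : (latticeTopology D).close (⊥ : Sieve d) f ↔ e = ⊥ := by
  constructor
  · rintro ⟨t, ht, rfl⟩
    exact (Finset.sup_eq_bot_iff _ _).2 fun c hc => (ht c hc).2.elim
  · rintro rfl
    exact ⟨∅, by simp, by simp⟩

/-- By distributivity, any `e ≤ p ⊔ q` is covered by `e ⊓ p` and `e ⊓ q`. Joins of principal closed
sieves are thus joins in the lattice. -/
theorem close_iff_le_sup {S : Sieve d} {p q : D} (hS : ∀ (c : D) (g : c ⟶ d), S g ↔ c ≤ p ∨ c ≤ q)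
    (f : e ⟶ d) : (latticeTopology D).close S f ↔ e ≤ p ⊔ q := by
  classical
  constructor
  · rintro ⟨t, ht, rfl⟩
    refine Finset.sup_le fun c hc => ?_
    obtain ⟨h, h'⟩ := ht c hc
    exact ((hS _ _).1 h').elim le_sup_of_le_left le_sup_of_le_right
  · intro h
    refine ⟨{e ⊓ p, e ⊓ q}, ?_, ?_⟩
    · intro c hc
      rw [Finset.mem_insert, Finset.mem_singleton] at hc
      rcases hc with rfl | rfl
      · exact ⟨inf_le_left, (hS _ _).2 (Or.inl inf_le_right)⟩
      · exact ⟨inf_le_left, (hS _ _).2 (Or.inr inf_le_right)⟩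
    · simpa [← inf_sup_left] using h

/-- A presheaf of rigs is really local if the invertibility of sections is controlled by a
lattice-valued map which preserves the rig operations. -/
theorem isReallyLocal_of_isUnit_iff_le {X : Dᵒᵖ ⥤ CommSemiRingCat.{u}}
    (χ : ∀ d : D, X.obj (op d) → D)
    (hχ : ∀ (d : D) (x : X.obj (op d)) (c : D) (g : c ⟶ d), invSieve X x g ↔ c ≤ χ d x)
    (h0 : ∀ d, χ d 0 = ⊥) (hadd : ∀ d x y, χ d (x + y) = χ d x ⊔ χ d y) : IsReallyLocal X where
  map_zero d := by
    ext c g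
    rw [hχ, h0, le_bot_iff, close_bot_iff]
  map_add d x y := by
    ext c g
    rw [hχ, hadd]
    refine (close_iff_le_sup (fun c g => ?_) g).symm
    rw [← hχ d x c g, ← hχ d y c g]
    rfl
  map_one d := by
    ext c g
    refine iff_of_true ?_ trivial
    change IsUnit ((X.map g.op).hom 1)
    rw [map_one]
    exact isUnit_one
  map_mul d x y := by
    ext c g
    change IsUnit ((X.map g.op).hom (x * y)) ↔ _
    rw [map_mul, IsUnit.mul_iff]
    rfl

end Close

namespace Rig

/-! ## The structure sheaf of an integral rig -/

section StructureSheaf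

open Reticulation

variable {A : Type u} [CommSemiring A] {c d : Reticulation A} {x y z x' y' : A}

/-- The inequality `x ≤ y` over `d`, that is, after inverting the elements whose class is above
`d`. -/
def LeOn (d : Reticulation A) (x y : A) : Prop := ∃ u : A, d ≤ mk u ∧ Le (u * x) y

theorem LeOn.mono (h : c ≤ d) (hxy : LeOn d x y) : LeOn c x y := by
  obtain ⟨u, hu, hxy⟩ := hxy
  exact ⟨u, h.trans hu, hxy⟩

theorem LeOn.of_le (hA : Integral A) (d : Reticulation A) (h : Le x y) : LeOn d x y := by
  obtain ⟨a, rfl⟩ := mk_surjective d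
  exact ⟨a, le_rfl, (hA.mul_le_right a x).trans h⟩

theorem one_leOn : LeOn d 1 x ↔ d ≤ mk x := by
  refine ⟨?_, fun h => ⟨x, h, by simpa using Le.refl x⟩⟩
  rintro ⟨u, hu, h⟩
  exact hu.trans (mk_mono (by simpa using h))

variable [hA : Fact (Integral A)]

theorem LeOn.refl (d : Reticulation A) (x : A) : LeOn d x x := .of_le hA.out d (.refl x)

theorem LeOn.trans (h : LeOn d x y) (h' : LeOn d y z) : LeOn d x z := by
  obtain ⟨u, hu, h⟩ := h
  obtain ⟨v, hv, h'⟩ := h'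
  refine ⟨v * u, le_inf hv hu, ?_⟩
  rw [mul_assoc]
  exact ((Le.refl v).mul h).trans h'

theorem LeOn.add (h : LeOn d x y) (h' : LeOn d x' y') : LeOn d (x + x') (y + y') := by
  obtain ⟨u, hu, h⟩ := h
  obtain ⟨v, hv, h'⟩ := h'
  refine ⟨u * v, le_inf hu hv, ?_⟩
  rw [mul_add]
  exact (((hA.out.mul_le_left u v).mul (Le.refl x)).trans h).add
    (((hA.out.mul_le_right u v).mul (Le.refl x')).trans h')

theorem LeOn.mul (h : LeOn d x y) (h' : LeOn d x' y') : LeOn d (x * x') (y * y') := by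
  obtain ⟨u, hu, h⟩ := h
  obtain ⟨v, hv, h'⟩ := h'
  refine ⟨u * v, le_inf hu hv, ?_⟩
  rw [mul_mul_mul_comm]
  exact h.mul h'

/-- The order is local: if `u` and `v` witness it on the two pieces, then `u + v` does on the join.
-/
theorem LeOn.sup (h : LeOn c x y) (h' : LeOn d x y) : LeOn (c ⊔ d) x y := by
  obtain ⟨u, hu, h⟩ := h
  obtain ⟨v, hv, h'⟩ := h'
  refine ⟨u + v, sup_le_sup hu hv, ?_⟩
  rw [add_mul]
  exact hA.out.add_le h h'

theorem LeOn.bot (x y : A) : LeOn ⊥ x y := ⟨0, bot_le, by simpa using zero_le y⟩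

/-- An element whose class is `⊤` is above a power of `1`, hence equals `1`. This makes the global
sections `A` itself. -/
theorem leOn_top : LeOn ⊤ x y ↔ Le x y := by
  refine ⟨?_, .of_le hA.out _⟩
  rintro ⟨u, ⟨n, hu⟩, h⟩
  rw [one_pow, hA.out.one_le_iff] at hu
  rwa [hu, one_mul] at h

/-- The congruence whose quotient is the rig of sections over `d` of the structure sheaf. -/
def localCon (d : Reticulation A) : RingCon A where
  r x y := LeOn d x y ∧ LeOn d y x
  iseqv :=
    { refl x := ⟨.refl d x, .refl d x⟩
      symm h := h.symm
      trans h h' := ⟨h.1.trans h'.1, h'.2.trans h.2⟩ }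
  add' h h' := ⟨h.1.add h'.1, h.2.add h'.2⟩
  mul' h h' := ⟨h.1.mul h'.1, h.2.mul h'.2⟩

theorem localCon_iff : localCon d x y ↔ LeOn d x y ∧ LeOn d y x := Iff.rfl

theorem localCon_mono (h : c ≤ d) (hxy : localCon d x y) : localCon c x y :=
  ⟨hxy.1.mono h, hxy.2.mono h⟩

theorem localCon_one : localCon d x 1 ↔ d ≤ mk x :=
  ⟨fun h => one_leOn.1 h.2, fun h => ⟨.of_le hA.out d (hA.out.le_one x), one_leOn.2 h⟩⟩

theorem localCon_finset_sup {ι : Type*} (t : Finset ι) (f : ι → Reticulation A)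
    (h : ∀ i ∈ t, localCon (f i) x y) : localCon (t.sup f) x y := by
  classical
  induction t using Finset.induction_on with
  | empty => exact ⟨.bot x y, .bot y x⟩
  | insert i t _ ih =>
    rw [Finset.sup_insert]
    have h1 := h i (Finset.mem_insert_self i t)
    have h2 := ih fun j hj => h j (Finset.mem_insert_of_mem hj)
    exact ⟨h1.1.sup h2.1, h1.2.sup h2.2⟩

/-- Separatedness: equality over `d` may be checked on a finite cover. -/
theorem localCon_of_sup_eq (t : Finset (Reticulation A)) (ht : d ≤ t.sup id)
    (h : ∀ c ∈ t, localCon (d ⊓ c) x y) : localCon d x y := by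
  have h1 := localCon_finset_sup t (d ⊓ ·) h
  have h2 : t.sup (d ⊓ ·) = d ⊓ t.sup id := (Finset.sup_inf_distrib_left t id d).symm
  rwa [h2, inf_eq_left.2 ht] at h1

theorem exists_glue_pair (h : localCon (c ⊓ d) x y) : ∃ z, localCon c z x ∧ localCon d z y := by
  obtain ⟨a, rfl⟩ := mk_surjective c
  obtain ⟨b, rfl⟩ := mk_surjective d
  obtain ⟨⟨u, ⟨m, hu⟩, hxy⟩, ⟨v, ⟨n, hv⟩, hyx⟩⟩ := h
  replace hu : Le (a ^ m * b ^ m) u := by rwa [← mul_pow]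
  replace hv : Le (a ^ n * b ^ n) v := by rwa [← mul_pow]
  -- Higher powers are smaller, so the single exponent `m + n` serves both inequalities.
  have key : ∀ k l : ℕ, Le (a ^ (k + l)) (a ^ k) ∧ Le (b ^ (k + l)) (b ^ k) := fun k l =>
    ⟨pow_add a k l ▸ hA.out.mul_le_left _ _, pow_add b k l ▸ hA.out.mul_le_left _ _⟩
  have hxy' : Le (b ^ (m + n) * (a ^ (m + n) * x)) y := by
    rw [← mul_assoc, mul_comm (b ^ _)]
    exact ((((key m n).1.mul (key m n).2).trans hu).mul (Le.refl x)).trans hxy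
  have hyx' : Le (a ^ (m + n) * (b ^ (m + n) * y)) x := by
    rw [← mul_assoc, add_comm m n]
    exact ((((key n m).1.mul (key n m).2).trans hv).mul (Le.refl y)).trans hyx
  -- Over `c` the power of `a` becomes `1` and `b ^ (m + n) * y` lies below `x`, so the sum becomes
  -- `x`; symmetrically it becomes `y` over `d`.
  refine ⟨a ^ (m + n) * x + b ^ (m + n) * y,
    ⟨⟨a ^ (m + n), mk_le_mk_pow _ _, ?_⟩, ⟨a ^ (m + n), mk_le_mk_pow _ _, le_add_right _ _⟩⟩,
    ⟨⟨b ^ (m + n), mk_le_mk_pow _ _, ?_⟩, ⟨b ^ (m + n), mk_le_mk_pow _ _, le_add_left _ _⟩⟩⟩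
  · rw [mul_add]
    exact hA.out.add_le ((hA.out.mul_le_right _ _).trans (hA.out.mul_le_right _ _)) hyx'
  · rw [mul_add]
    exact hA.out.add_le hxy' ((hA.out.mul_le_right _ _).trans (hA.out.mul_le_right _ _))

theorem exists_glue (t : Finset (Reticulation A)) (r : Reticulation A → A)
    (h : ∀ c ∈ t, ∀ d ∈ t, localCon (c ⊓ d) (r c) (r d)) : ∃ z, ∀ c ∈ t, localCon c z (r c) := by
  classical
  induction t using Finset.induction_on with
  | empty => exact ⟨0, by simp⟩
  | insert d t _ ih =>
    obtain ⟨w, hw⟩ := ih fun c hc e he =>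
      h c (Finset.mem_insert_of_mem hc) e (Finset.mem_insert_of_mem he)
    -- The part `w` glued so far lives over `t.sup id`; its agreement with `r d` on the overlap is
    -- checked on the members of `t`, reducing to a gluing of two sections.
    have hdw : localCon (t.sup id ⊓ d) w (r d) := by
      refine localCon_of_sup_eq t inf_le_left fun c hc => ?_
      refine (localCon _).trans (localCon_mono inf_le_right (hw c hc)) (localCon_mono ?_
        (h c (Finset.mem_insert_of_mem hc) d (Finset.mem_insert_self d t)))
      exact le_inf inf_le_right (inf_le_left.trans inf_le_right)
    obtain ⟨z, hz, hzd⟩ := exists_glue_pair hdw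
    refine ⟨z, fun c hc => ?_⟩
    rcases Finset.mem_insert.1 hc with rfl | hc
    · exact hzd
    · exact (localCon _).trans (localCon_mono (Finset.le_sup (f := id) hc) hz) (hw c hc)

variable (A) in
/-- The structure sheaf of an integral rig, on its reticulation. -/
def structureSheaf : (Reticulation A)ᵒᵖ ⥤ CommSemiRingCat.{u} where
  obj d := .of (localCon d.unop).Quotient
  map {d c} g := CommSemiRingCat.ofHom <| (localCon d.unop).lift (localCon c.unop).mk'
    fun _ _ h => (RingCon.eq _).2 (localCon_mono (leOfHom g.unop) h)
  map_id d := by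
    ext x
    rfl
  map_comp f g := by
    ext x
    rfl

/-- The section over `d` of the structure sheaf given by an element of the rig. -/
def localSection (d : Reticulation A) : A →+* (structureSheaf A).obj (op d) := (localCon d).mk'

theorem localSection_surjective (d : Reticulation A) : Function.Surjective (localSection d) :=
  RingCon.mk'_surjective _

theorem localSection_eq_iff : localSection d x = localSection d y ↔ localCon d x y :=
  RingCon.eq _

theorem map_localSection (g : c ⟶ d) (x : A) :
    ((structureSheaf A).map g.op).hom (localSection d x) = localSection c x := rfl

theorem localSection_eq_one : localSection d x = 1 ↔ d ≤ mk x :=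
  localSection_eq_iff.trans localCon_one

/-- The witness `u` becomes `1` over `d`, so the order of the quotient rig is the one that defines
the congruence. -/
theorem localSection_le : Le (localSection d x) (localSection d y) ↔ LeOn d x y := by
  constructor
  · rintro ⟨w, hw⟩
    obtain ⟨w, rfl⟩ := localSection_surjective d w
    rw [← map_add, localSection_eq_iff] at hw
    exact (LeOn.of_le hA.out d (le_add_left x w)).trans hw.1
  · rintro ⟨u, hu, h⟩
    simpa [localSection_eq_one.2 hu] using h.map (localSection d)

theorem integral_structureSheaf (d : Reticulation A) :
    Integral ((structureSheaf A).obj (op d)) := fun x => by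
  obtain ⟨x, rfl⟩ := localSection_surjective d x
  rw [← map_one (localSection d), ← map_add, hA.out]

theorem isSheaf_structureSheaf : Presieve.IsSheaf (latticeTopology (Reticulation A))
    (structureSheaf A ⋙ forget CommSemiRingCat.{u}) := by
  rintro d S ⟨t, ht, hd⟩ s hs
  -- Lifts are chosen per object, as arrows `c ⟶ d` are unique; outside the sieve the value `0` is a
  -- dummy.
  have hr : ∀ c, ∃ r : A, ∀ (g : c ⟶ d) (hg : S g), localSection c r = s g hg := by
    intro c
    by_cases h : ∃ g : c ⟶ d, S g
    · obtain ⟨g, hg⟩ := h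
      obtain ⟨r, hr⟩ := localSection_surjective c (s g hg)
      exact ⟨r, fun g' _ => by obtain rfl := Subsingleton.elim g g'; exact hr⟩
    · exact ⟨0, fun g hg => (h ⟨g, hg⟩).elim⟩
  choose r hr using hr
  have compat : ∀ (b c : Reticulation A) (g : b ⟶ d) (g' : c ⟶ d), S g → S g' →
      localCon (b ⊓ c) (r b) (r c) := by
    intro b c g g' hg hg'
    rw [← localSection_eq_iff, ← map_localSection (homOfLE (inf_le_left : b ⊓ c ≤ b)),
      ← map_localSection (homOfLE (inf_le_right : b ⊓ c ≤ c)), hr b g hg, hr c g' hg']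
    exact hs (homOfLE inf_le_left) (homOfLE inf_le_right) hg hg' rfl
  obtain ⟨z, hz⟩ := exists_glue t r fun b hb c hc => by
    obtain ⟨h, h1⟩ := ht b hb
    obtain ⟨h', h2⟩ := ht c hc
    exact compat b c _ _ h1 h2
  refine ⟨localSection d z, fun e g hg => ?_, fun y hy => ?_⟩
  · refine Eq.trans (localSection_eq_iff.2 ?_) (hr e g hg)
    refine localCon_of_sup_eq t (hd ▸ leOfHom g) fun c hc => ?_
    obtain ⟨h, h1⟩ := ht c hc
    refine (localCon _).trans (localCon_mono inf_le_right (hz c hc)) ?_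
    exact (localCon _).symm (compat e c _ _ hg h1)
  · obtain ⟨y, rfl⟩ := localSection_surjective d y
    refine localSection_eq_iff.2 (localCon_of_sup_eq t hd.ge fun c hc => ?_)
    obtain ⟨h, h1⟩ := ht c hc
    refine localCon_mono inf_le_right ((localCon _).trans ?_ ((localCon _).symm (hz c hc)))
    exact localSection_eq_iff.1 ((hy _ h1).trans (hr c _ h1).symm)

theorem isGreatest_localSection_eq_one (d : Reticulation A) (x : A) :
    IsGreatest {c | ∃ h : c ≤ d, restrict (structureSheaf A) h (localSection d x) = 1}
      (d ⊓ mk x) :=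
  ⟨⟨inf_le_left, localSection_eq_one.2 inf_le_right⟩,
    fun _ ⟨h, hc⟩ => le_inf h (localSection_eq_one.1 hc)⟩

theorem isPrincipalOne_structureSheaf : IsPrincipalOne (structureSheaf A) := fun d x => by
  obtain ⟨x, rfl⟩ := localSection_surjective d x
  exact ⟨_, isGreatest_localSection_eq_one d x⟩

theorem chi_localSection (d : Reticulation A) (x : A) :
    (isPrincipalOne_structureSheaf.chi (localSection d x) : Reticulation A) = d ⊓ mk x :=
  (isPrincipalOne_structureSheaf.isGreatest_chi _).unique (isGreatest_localSection_eq_one d x)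

theorem isReallyLocal_structureSheaf : IsReallyLocal (structureSheaf A) := by
  refine isReallyLocal_of_isUnit_iff_le
    (fun d x => (isPrincipalOne_structureSheaf.chi x : Reticulation A)) ?_ ?_ ?_
  · intro d x c g
    obtain ⟨x, rfl⟩ := localSection_surjective d x
    rw [chi_localSection]
    refine (integral_structureSheaf c).isUnit_iff.trans ?_
    rw [map_localSection, localSection_eq_one, le_inf_iff]
    exact ⟨fun h => ⟨leOfHom g, h⟩, fun h => h.2⟩
  · intro d
    rw [← map_zero (localSection d), chi_localSection, mk_zero, inf_bot_eq]
  · intro d x y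
    obtain ⟨x, rfl⟩ := localSection_surjective d x
    obtain ⟨y, rfl⟩ := localSection_surjective d y
    rw [← map_add, chi_localSection, chi_localSection, chi_localSection, mk_add, inf_sup_left]

/-- The same `u` witnesses both sides: slide it past `x` and apply the adjunction in `A`. -/
theorem Residuated.localSection_mul_le_iff (h : Residuated A) (d : Reticulation A) (x y z : A) :
    Le (localSection d x * localSection d z) (localSection d y) ↔
      Le (localSection d z) (localSection d (h.imp x y)) := by
  rw [← map_mul, localSection_le, localSection_le]
  constructor
  · rintro ⟨u, hu, hxy⟩
    exact ⟨u, hu, (h.mul_le_iff _ _ _).1 (by rwa [mul_left_comm])⟩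
  · rintro ⟨u, hu, hxy⟩
    exact ⟨u, hu, by simpa only [mul_left_comm] using (h.mul_le_iff _ _ _).2 hxy⟩

theorem Residuated.structureSheaf (h : Residuated A) (d : Reticulation A) :
    Residuated ((structureSheaf A).obj (op d)) where
  add_self := (integral_structureSheaf d).add_self
  exists_adjoint x := by
    obtain ⟨x, rfl⟩ := localSection_surjective d x
    -- Any lift of `y` would do, since the adjunction determines the residual.
    refine ⟨fun y => localSection d (h.imp x (Function.surjInv (localSection_surjective d) y)),
      fun z y => ?_⟩
    obtain ⟨z, rfl⟩ := localSection_surjective d z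
    rw [← h.localSection_mul_le_iff, Function.surjInv_eq (localSection_surjective d)]

theorem Residuated.localSection_imp (h : Residuated A) (d : Reticulation A) (x y : A) :
    localSection d (h.imp x y) =
      (h.structureSheaf d).imp (localSection d x) (localSection d y) := by
  refine (h.structureSheaf d).eq_imp fun z => ?_
  obtain ⟨z, rfl⟩ := localSection_surjective d z
  exact h.localSection_mul_le_iff d x y z

end StructureSheaf

end Rig

/-! ### Functoriality of restriction. -/

section Restrict

variable {D : Type u} [DistribLattice D] (X : Dᵒᵖ ⥤ CommSemiRingCat.{u}) {b c d : D}

theorem restrict_rfl (x : X.obj (op d)) : restrict X le_rfl x = x :=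
  congrArg (fun k => k.hom x) (X.map_id (op d))

theorem restrict_restrict (h : c ≤ d) (h' : b ≤ c) (x : X.obj (op d)) :
    restrict X h' (restrict X h x) = restrict X (h'.trans h) x :=
  (congrArg (fun k => k.hom x) (X.map_comp (homOfLE h).op (homOfLE h').op)).symm

end Restrict

/-! ## The map `χ` of a representation -/

namespace RigRepresentation

variable (P : RigRepresentation.{u}) {c d : P.D}

theorem le_chi_iff (h : c ≤ d) (x : P.X.obj (op d)) :
    c ≤ (P.principal.chi x : P.D) ↔ restrict P.X h x = 1 := by
  obtain ⟨⟨hd, h1⟩, h2⟩ := P.principal.isGreatest_chi x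
  refine ⟨fun hc => ?_, fun hc => h2 ⟨h, hc⟩⟩
  rw [← restrict_restrict P.X hd hc, h1, map_one]

theorem invSieve_iff_le_chi (x : P.X.obj (op d)) (g : c ⟶ d) :
    invSieve P.X x g ↔ c ≤ (P.principal.chi x : P.D) :=
  (P.integral c).isUnit_iff.trans (P.le_chi_iff (leOfHom g) x).symm

theorem chi_le (x : P.X.obj (op d)) : (P.principal.chi x : P.D) ≤ d := (P.principal.chi x).2

theorem chi_restrict (h : c ≤ d) (x : P.X.obj (op d)) :
    (P.principal.chi (restrict P.X h x) : P.D) = c ⊓ (P.principal.chi x : P.D) := by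
  refine eq_of_forall_le_iff fun b => ?_
  by_cases hb : b ≤ c
  · rw [P.le_chi_iff hb, le_inf_iff, P.le_chi_iff (hb.trans h), and_iff_right hb, restrict_restrict]
  · exact iff_of_false (fun hx => hb (hx.trans (P.chi_le _))) fun hx => hb (hx.trans inf_le_left)

theorem chi_zero : (P.principal.chi (0 : P.X.obj (op d)) : P.D) = ⊥ := by
  have h : invSieve P.X (0 : P.X.obj (op d)) (homOfLE (P.chi_le (0 : P.X.obj (op d)))) :=
    (P.invSieve_iff_le_chi _ _).2 le_rfl
  rw [P.reallyLocal.map_zero] at h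
  exact (close_bot_iff _).1 h

theorem chi_one : (P.principal.chi (1 : P.X.obj (op d)) : P.D) = d :=
  (P.chi_le _).antisymm ((P.le_chi_iff le_rfl _).2 (map_one _))

/-- Real locality makes the invertibility sieve of a sum the closure of a union; by
`close_iff_le_sup` that is a join. For products, integrality suffices. -/
theorem chi_add (x y : P.X.obj (op d)) :
    (P.principal.chi (x + y) : P.D) = (P.principal.chi x : P.D) ⊔ (P.principal.chi y : P.D) := by
  refine eq_of_forall_le_iff fun b => ?_
  by_cases hb : b ≤ d
  · rw [← P.invSieve_iff_le_chi _ (homOfLE hb), P.reallyLocal.map_add]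
    refine close_iff_le_sup (fun c g => ?_) _
    rw [← P.invSieve_iff_le_chi x g, ← P.invSieve_iff_le_chi y g]
    rfl
  · exact iff_of_false (fun hx => hb (hx.trans (P.chi_le _)))
      fun hx => hb (hx.trans (sup_le (P.chi_le x) (P.chi_le y)))

theorem chi_mul (x y : P.X.obj (op d)) :
    (P.principal.chi (x * y) : P.D) = (P.principal.chi x : P.D) ⊓ (P.principal.chi y : P.D) := by
  refine eq_of_forall_le_iff fun b => ?_
  by_cases hb : b ≤ d
  · rw [le_inf_iff, P.le_chi_iff hb, P.le_chi_iff hb, P.le_chi_iff hb, map_mul,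
      (P.integral b).mul_eq_one_iff]
  · exact iff_of_false (fun hx => hb (hx.trans (P.chi_le _)))
      fun hx => hb ((hx.trans inf_le_left).trans (P.chi_le x))

/-- Maps of representations agree when their lattice components and their components on sections
do. -/
theorem hom_ext {P Q : RigRepresentation.{u}} {h k : P ⟶ Q} (hf : ∀ d, h.f d = k.f d)
    (hφ : ∀ (d : P.D) (x : P.X.obj (op d)),
      (k.φ.app (op d)).hom x = restrict Q.X (hf d).ge ((h.φ.app (op d)).hom x)) : h = k := by
  obtain ⟨f, φ, _⟩ := h
  obtain ⟨f', φ', _⟩ := k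
  obtain rfl : f = f' := BddDistLat.ext hf
  have : φ = φ' := by
    ext d x
    exact ((hφ d.unop x).trans (restrict_rfl Q.X _)).symm
  subst this
  rfl

end RigRepresentation

/-! ## The representation of an integral rig and its universal property -/

namespace Rig

open RigRepresentation Reticulation

variable (A : Type u) [CommSemiring A] [Fact (Integral A)]

/-- The representation of an integral rig by its structure sheaf. -/
def representation : RigRepresentation.{u} where
  D := .of (Reticulation A)
  X := structureSheaf A
  isSheaf := isSheaf_structureSheaf
  integral := integral_structureSheaf
  reallyLocal := isReallyLocal_structureSheaf
  principal := isPrincipalOne_structureSheaf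

variable {A} {P : RigRepresentation.{u}} (g : A →+* P.X.obj (op ⊤))

/-- The lattice morphism sending the class of `x` to `χ (g x)`. -/
def liftLattice : BoundedLatticeHom (Reticulation A) P.D :=
  Reticulation.lift (fun x => (P.principal.chi (g x) : P.D))
    (by rw [map_zero, P.chi_zero]) (by rw [map_one, P.chi_one])
    (fun x y => by rw [map_add, P.chi_add]) (fun x y => by rw [map_mul, P.chi_mul])

theorem liftLattice_mk (x : A) : liftLattice g (mk x) = P.principal.chi (g x) := rfl

/-- If `d ≤ mk u`, the image of `d` is below `χ (g u)`, so `g u` restricts to `1` there and drops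
out of `g u * g x ≤ g y`. -/
theorem LeOn.restrict_le {d : Reticulation A} {x y : A} (h : LeOn d x y) :
    Le (restrict P.X (le_top : liftLattice g d ≤ ⊤) (g x))
      (restrict P.X (le_top : liftLattice g d ≤ ⊤) (g y)) := by
  obtain ⟨u, hu, h⟩ := h
  have h1 : liftLattice g d ≤ P.principal.chi (g u) :=
    (OrderHomClass.mono (liftLattice g) hu).trans_eq (liftLattice_mk g u)
  rw [P.le_chi_iff le_top] at h1
  simpa [h1] using (h.map g).map (restrict P.X (le_top : liftLattice g d ≤ ⊤))

/-- The map on sections over `d` induced by `g`. -/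
def liftSection (d : Reticulation A) :
    (structureSheaf A).obj (op d) →+* P.X.obj (op (liftLattice g d)) :=
  (localCon d).lift ((restrict P.X (le_top : liftLattice g d ≤ ⊤)).comp g) fun _ _ h =>
    (P.integral _).antisymm (h.1.restrict_le g) (h.2.restrict_le g)

/-- The map of representations induced by `g`. -/
def liftRepresentation : representation A ⟶ P where
  f := BddDistLat.ofHom (liftLattice g)
  φ :=
    { app d := CommSemiRingCat.ofHom (liftSection g d.unop)
      naturality d c k := by
        ext x
        obtain ⟨x, rfl⟩ := localSection_surjective d.unop x
        exact (restrict_restrict P.X le_top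
          (OrderHomClass.mono (liftLattice g) (leOfHom k.unop)) (g x)).symm }
  comm d x := by
    obtain ⟨x, rfl⟩ := localSection_surjective d x
    refine Subtype.ext ((P.chi_restrict le_top (g x)).trans ?_)
    exact ((congrArg (liftLattice g) (chi_localSection d x)).trans
      ((liftLattice g).map_inf' d (mk x))).symm

theorem liftRepresentation_globalSections (x : A) :
    (globalSections.map (liftRepresentation g)).hom (localSection ⊤ x) = g x :=
  (restrict_restrict P.X le_top (map_top (liftLattice g)).ge (g x)).trans (restrict_rfl P.X (g x))

/-- The square with `χ`, read at `⊤`, leaves no freedom in the lattice component. -/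
theorem map_mk_eq_chi (h : representation A ⟶ P) (x : A) : h.f (mk x) =
    (P.principal.chi ((globalSections.map h).hom (localSection ⊤ x)) : P.D) := by
  refine Eq.trans ?_ (P.chi_restrict (map_top h.f.hom).ge
    ((h.φ.app (op ⊤)).hom (localSection ⊤ x))).symm
  refine Eq.trans ?_ (congrArg (⊤ ⊓ ·) (congrArg Subtype.val (h.comm ⊤ (localSection ⊤ x))).symm)
  refine Eq.trans ?_ (top_inf_eq _).symm
  exact congrArg h.f ((chi_localSection ⊤ x).trans (top_inf_eq _)).symm

/-- Naturality along `d ≤ ⊤`: since all local sections are restrictions of global ones, `φ` is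
determined at `⊤`. -/
theorem app_localSection (h : representation A ⟶ P) (d : Reticulation A) (x : A) :
    (h.φ.app (op d)).hom (localSection d x) = restrict P.X (le_top : h.f d ≤ ⊤)
      ((globalSections.map h).hom (localSection ⊤ x)) :=
  (congrArg (fun k => k.hom (localSection ⊤ x))
    (h.φ.naturality (homOfLE (le_top : d ≤ ⊤)).op)).trans
    (restrict_restrict P.X (map_top h.f.hom).ge (le_top : h.f d ≤ ⊤) _).symm

theorem representation_hom_ext {h k : representation A ⟶ P}
    (hk : ∀ x : A, (globalSections.map h).hom (localSection ⊤ x) =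
      (globalSections.map k).hom (localSection ⊤ x)) : h = k := by
  refine hom_ext (fun d => ?_) fun d x => ?_
  · obtain ⟨x, rfl⟩ := mk_surjective d
    exact (map_mk_eq_chi h x).trans ((hk x).symm ▸ (map_mk_eq_chi k x).symm)
  · obtain ⟨x, rfl⟩ := localSection_surjective d x
    refine (app_localSection k d x).trans ((congrArg _ (hk x).symm).trans ?_)
    refine (restrict_restrict P.X _ _ _).symm.trans (congrArg _ (app_localSection h d x).symm)

end Rig

/-! ## The left adjoint of global sections -/

namespace RiRig

open Rig

variable (A : RiRig.{u}) {P : ResiduatedRigRepresentation.{u}}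

instance : Fact (Integral A.rig) := ⟨A.integral⟩

/-- The representation of a residuated integral rig by its structure sheaf. -/
def representation : ResiduatedRigRepresentation.{u} where
  toRigRepresentation := Rig.representation A.rig
  residuated := A.residuated.structureSheaf
  restrict_imp {c d} h x y := by
    obtain ⟨x, rfl⟩ := localSection_surjective d x
    obtain ⟨y, rfl⟩ := localSection_surjective d y
    exact (congrArg _ (A.residuated.localSection_imp d x y).symm).trans
      (A.residuated.localSection_imp c x y)

/-- The unit: an element of `A` seen as a global section. -/
def toGamma : A ⟶ ResiduatedRigRepresentation.Gamma.obj A.representation where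
  hom := CommSemiRingCat.ofHom (localSection ⊤)
  map_imp := A.residuated.localSection_imp ⊤

variable {A}

/-- The map of residuated representations induced by a morphism to the rig of global sections. -/
def liftRepresentation (g : A ⟶ ResiduatedRigRepresentation.Gamma.obj P) : A.representation ⟶ P where
  hom := Rig.liftRepresentation g.hom.hom
  map_imp d x y := by
    obtain ⟨x, rfl⟩ := localSection_surjective d x
    obtain ⟨y, rfl⟩ := localSection_surjective d y
    refine (congrArg _ (A.residuated.localSection_imp d x y).symm).trans ?_
    exact (congrArg _ (g.map_imp x y)).trans (P.restrict_imp _ _ _)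

/-- The universal property of the representation of a residuated integral rig. -/
def representationHomEquiv (A : RiRig.{u}) (P : ResiduatedRigRepresentation.{u}) :
    (A.representation ⟶ P) ≃ (A ⟶ ResiduatedRigRepresentation.Gamma.obj P) where
  toFun h := A.toGamma ≫ ResiduatedRigRepresentation.Gamma.map h
  invFun := liftRepresentation
  left_inv h := by
    refine ResiduatedRigRepresentation.Hom.ext (representation_hom_ext fun x => ?_)
    exact liftRepresentation_globalSections _ x
  right_inv g := by
    refine RiRig.Hom.ext ?_
    ext x
    exact liftRepresentation_globalSections _ x

theorem representationHomEquiv_naturality (A : RiRig.{u}) (P Q : ResiduatedRigRepresentation.{u})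
    (k : P ⟶ Q) (h : A.representation ⟶ P) : representationHomEquiv A Q (h ≫ k) =
      representationHomEquiv A P h ≫ ResiduatedRigRepresentation.Gamma.map k := by
  change A.toGamma ≫ ResiduatedRigRepresentation.Gamma.map (h ≫ k) = _
  rw [Functor.map_comp, ← Category.assoc]
  rfl

theorem localSection_top_bijective :
    Function.Bijective (localSection (⊤ : Reticulation A.rig)) := by
  refine ⟨fun x y h => ?_, localSection_surjective ⊤⟩
  rw [localSection_eq_iff, localCon_iff, leOn_top, leOn_top] at h
  exact A.integral.antisymm h.1 h.2

theorem isIso_toGamma (A : RiRig.{u}) : IsIso A.toGamma := by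
  let e := RingEquiv.ofBijective _ (localSection_top_bijective (A := A))
  refine ⟨⟨CommSemiRingCat.ofHom e.symm.toRingHom, fun x y => ?_⟩, ?_, ?_⟩
  · obtain ⟨x, rfl⟩ := e.surjective x
    obtain ⟨y, rfl⟩ := e.surjective y
    -- The inverse of a bijection preserving residuals preserves them.
    refine (congrArg e.symm (A.toGamma.map_imp x y).symm).trans ?_
    refine (e.symm_apply_apply _).trans ?_
    exact congrArg₂ _ (e.symm_apply_apply x).symm (e.symm_apply_apply y).symm
  · refine RiRig.Hom.ext ?_
    ext x
    exact e.symm_apply_apply x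
  · refine RiRig.Hom.ext ?_
    ext x
    exact e.apply_symm_apply x

/-- The functor sending a residuated integral rig to its representation. -/
def representationFunctor : RiRig.{u} ⥤ ResiduatedRigRepresentation.{u} :=
  Adjunction.leftAdjointOfEquiv representationHomEquiv representationHomEquiv_naturality

/-- The representation functor is left adjoint to global sections. -/
def representationAdjunction :
    representationFunctor.{u} ⊣ ResiduatedRigRepresentation.Gamma.{u} :=
  Adjunction.adjunctionOfEquivLeft representationHomEquiv representationHomEquiv_naturality

theorem representationAdjunction_unit_app (A : RiRig.{u}) :
    representationAdjunction.unit.app A = A.toGamma := by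
  have h := Adjunction.homEquiv_id representationAdjunction A
  refine h.symm.trans ?_
  exact (congrArg (A.toGamma ≫ ·) (CategoryTheory.Functor.map_id _ _)).trans (Category.comp_id _)

end RiRig

end

theorem mainTheorem2 :
    ∃ F : RiRig.{u} ⥤ ResiduatedRigRepresentation.{u},
      Nonempty (F ⊣ ResiduatedRigRepresentation.Gamma.{u}) ∧ F.Full ∧ F.Faithful := by
  have : ∀ A, IsIso (RiRig.representationAdjunction.{u}.unit.app A) := fun A => by
    rw [RiRig.representationAdjunction_unit_app]
    exact RiRig.isIso_toGamma A
  have : IsIso RiRig.representationAdjunction.{u}.unit := NatIso.isIso_of_isIso_app _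
  have hF := RiRig.representationAdjunction.{u}.fullyFaithfulLOfIsIsoUnit
  exact ⟨_, ⟨RiRig.representationAdjunction⟩, hF.full, hF.faithful⟩
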